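/- A deterministic position-faithful (p.f.) one-tape Turing machine has a semi-infinite tape whose leftmost cell holds a marker $\boxplus$ that occurs only there and cannot be modified. On input $x\in\Sigma^*$ ($\Sigma$ a finite alphabet not containing $\boxplus$ or the blank symbol $\boxdot$) it starts with tape content $\boxplus x\boxdot^\infty$ and its head at $\boxplus$. It computes $f:\Sigma^*\to\Sigma^*$ in linear time if there is a constant $c$ such that, for every $x\in\Sigma^*$, it reaches an accepting state and halts after at most $c(|x|+1)$ steps with tape content starting with $\boxplus f(x)\boxdot$ (the content after that $\boxdot$ is arbitrary). A function computed in linear time by some such machine is called p.f. linear-time computable. Let $G$ be a group with a finite set $S$ of semigroup generators (every element of $G$ is a product of elements of $S$). A Cayley p.f. linear-time computable representation of $G$ is a bijection $\psi:L\to G$, where $L\subseteq\Sigma^*$ is a language over a finite alphabet $\Sigma$, such that for every $s\in S$ there is a p.f. linear-time computable function $f_s:\Sigma^*\to\Sigma^*$ with $f_s(L)\subseteq L$ and $\psi(f_s(w))=\psi(w)s$ for all $w\in L$. **Theorem.** Let $\psi:L\to G$ be a Cayley p.f. linear-time computable representation of $G$, and let $A\subseteq G$ be any finite generating set of $G$.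 For $g\in G$ let $d_A(g)$ be the least length of a word over $A\cup A^{-1}$ that represents $g$. Then: 1. there is a constant $K>0$ such that for all $s\in A\cup A^{-1}$ and all $u,v\in L$ with $\psi(v)=\psi(u)s$ we have $\bigl||u|-|v|\bigr|\le K$; 2. there is a constant $C$ such that $|w|\le C\,(d_A(\psi(w))+1)$ for all $w\in L$. -/

import Mathlib

/-- The symbols that may stand in the cells to the right of the left end marker: the blank symbol,
the letters of the input alphabet, and further auxiliary symbols of the machine. The left end
marker is not among them, so it can never be written. -/
inductive TapeSymbol (α : Type*) (β : Type*) where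
  | blank : TapeSymbol α β
  | letter : α → TapeSymbol α β
  | aux : β → TapeSymbol α β

/-- Head movements. -/
inductive HeadMove where
  | left
  | stay
  | right

/-- The new position of a head at position `p`. There is nothing to the left of position `0`, so a
head at `0` that is told to move left stays at `0`. -/
def HeadMove.apply : HeadMove → ℕ → ℕ
  | .left, p => p - 1
  | .stay, p => p
  | .right, p => p + 1

/-- A deterministic position-faithful one-tape Turing machine with input alphabet `α`.
The tape is semi-infinite, with cells `0, 1, 2, …`. Cell `0` always holds the left end marker:
`startTransition` is the behaviour of the machine on reading that marker (nothing is written), and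
`transition` is its behaviour on reading any of the other symbols. -/
structure PFTuringMachine (α : Type*) where
  State : Type
  finite_state : Finite State
  Aux : Type
  finite_aux : Finite Aux
  init : State
  accepting : Set State
  startTransition : State → State × HeadMove
  transition : State → TapeSymbol α Aux → State × TapeSymbol α Aux × HeadMove

namespace PFTuringMachine

variable {α : Type*} (M : PFTuringMachine α)

/-- A configuration: the control state, the position of the head (`0` is the cell of the left end
marker), and the tape to the right of the marker: `tape i` is the content of cell `i + 1`. -/
structure Config where
  state : M.State
  head : ℕ
  tape : ℕ → TapeSymbol α M.Aux

/-- The initial tape content (to the right of the marker): the word `x` followed by blanks. -/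
def initTape (x : List α) (i : ℕ) : TapeSymbol α M.Aux :=
  match x[i]? with
  | some a => .letter a
  | none => .blank

/-- The initial configuration on input `x`: the head is at the left end marker. -/
def initConfig (x : List α) : M.Config :=
  ⟨M.init, 0, M.initTape x⟩

open Classical in
/-- One step of the computation. In an accepting state the machine has halted, and the
configuration no longer changes. -/
noncomputable def step (c : M.Config) : M.Config :=
  if c.state ∈ M.accepting then c
  else
    match c.head with
    | 0 =>
      let r := M.startTransition c.state
      ⟨r.1, r.2.apply 0, c.tape⟩
    | i + 1 =>
      let r := M.transition c.state (c.tape i)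
      ⟨r.1, r.2.2.apply (i + 1), Function.update c.tape i r.2.1⟩

/-- The configuration after `t` steps on input `x`. -/
noncomputable def run (x : List α) (t : ℕ) : M.Config :=
  M.step^[t] (M.initConfig x)

/-- The tape content to the right of the marker starts with the word `y` followed by a blank;
whatever comes after this blank is irrelevant. -/
def TapeStartsWith (tape : ℕ → TapeSymbol α M.Aux) (y : List α) : Prop :=
  (∀ (i : ℕ) (hi : i < y.length), tape i = .letter y[i]) ∧ tape y.length = .blank

/-- On input `x` the machine reaches an accepting state (and halts) within `t` steps,
with output `y`. -/
def OutputsWithin (x y : List α) (t : ℕ) : Prop :=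
  (M.run x t).state ∈ M.accepting ∧ M.TapeStartsWith (M.run x t).tape y

end PFTuringMachine

/-- A function on words is position-faithful linear-time computable if some deterministic
position-faithful one-tape Turing machine computes it in a number of steps that is at most linear
in the length of the input. -/
def PFLinearTimeComputable {α : Type*} (f : List α → List α) : Prop :=
  ∃ (M : PFTuringMachine α) (c : ℕ), ∀ x : List α, M.OutputsWithin x (f x) (c * (x.length + 1))

/-- `ψ : L → G` is a Cayley position-faithful linear-time computable representation of the group
`G` with respect to the finite set `S` of semigroup generators of `G`. -/
structure IsCayleyPFLinearTimeRepresentation {α G : Type*} [Group G] (S : Finset G)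
    (L : Language α) (ψ : {w : List α // w ∈ L} → G) : Prop where
  /-- every element of `G` is a product of elements of `S` -/
  generates : Submonoid.closure (S : Set G) = ⊤
  bijective : Function.Bijective ψ
  /-- right multiplication by each generator is computed on normal forms -/
  computable : ∀ s ∈ S, ∃ f : List α → List α, PFLinearTimeComputable f ∧
    ∃ hf : ∀ w ∈ L, f w ∈ L, ∀ (w : List α) (hw : w ∈ L), ψ ⟨f w, hf w hw⟩ = ψ ⟨w, hw⟩ * s

/-- The length of a shortest word over `A ∪ A⁻¹` that represents `g` (such words exist for all `g`
when `A` generates the group). -/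
noncomputable def geodesicLength {G : Type*} [Group G] (A : Finset G) (g : G) : ℕ :=
  sInf {n : ℕ | ∃ l : List G, (∀ a ∈ l, a ∈ A ∨ a⁻¹ ∈ A) ∧ l.prod = g ∧ l.length = n}

/-! The heart is that a linear-time machine never moves its head more than a constant beyond the end
of its input (`exists_head_le`), so it lengthens words by at most a constant. The two sides of a
boundary between cells influence each other only through its crossing sequence. On a long input of
length n, the c(n+1) steps leave many boundaries with short crossing sequences, and two of these
sequences agree (`exists_crossingSeq_eq`). Cutting out the factor between the two boundaries
preserves the distance by which the head overshoots the input (`run_append_of_crossingSeq_eq`). By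
descent this overshoot is at most the running time on short inputs.

Hence right multiplication by an element of S, and so by any product of such elements, lengthens
normal forms boundedly. Since S generates G as a monoid, inverses are covered too, which makes the
bound two-sided. Adding the bounds along a geodesic gives the linear estimate. -/

namespace PFTuringMachine

variable {α : Type*} (M : PFTuringMachine α)

/-- The step at time `t` on input `x` moves the head between the cells `p` and `p + 1`. -/
def Crosses (x : List α) (p t : ℕ) : Prop :=
  ¬ ((M.run x t).head ≤ p ↔ (M.run x (t + 1)).head ≤ p)

open Classical in
/-- The crossing sequence of the first `T` steps at the boundary between the cells `p` and `p + 1`: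
the states entered on crossing the boundary. -/
noncomputable def crossingSeq (x : List α) (p : ℕ) : ℕ → List M.State
  | 0 => []
  | T + 1 => if M.Crosses x p T then crossingSeq x p T ++ [(M.run x (T + 1)).state]
      else crossingSeq x p T

variable {M}

/-! ### Single steps and crossing sequences -/

theorem run_succ (x : List α) (t : ℕ) : M.run x (t + 1) = M.step (M.run x t) := by
  simp [run, Function.iterate_succ_apply']

theorem step_of_accepting {c : M.Config} (h : c.state ∈ M.accepting) : M.step c = c := by
  simp [step, h]

theorem run_eq_of_accepting {x : List α} {N : ℕ} (h : (M.run x N).state ∈ M.accepting)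
    (j : ℕ) : M.run x (N + j) = M.run x N := by
  induction j with
  | zero => rfl
  | succ j ih => rw [← Nat.add_assoc, run_succ, ih, step_of_accepting h]

theorem step_head_le (c : M.Config) : (M.step c).head ≤ c.head + 1 := by
  unfold step
  split_ifs with h
  · omega
  · rcases hc : c.head with _ | i
    · simp only
      cases (M.startTransition c.state).2 <;> simp [HeadMove.apply]
    · simp only
      cases (M.transition c.state (c.tape i)).2.2 <;> simp only [HeadMove.apply] <;> omega

theorem le_step_head (c : M.Config) : c.head ≤ (M.step c).head + 1 := by
  unfold step
  split_ifs with h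
  · omega
  · rcases hc : c.head with _ | i
    · simp
    · simp only
      cases (M.transition c.state (c.tape i)).2.2 <;> simp only [HeadMove.apply] <;> omega

theorem step_tape_of_ne (c : M.Config) {i : ℕ} (hi : c.head ≠ i + 1) :
    (M.step c).tape i = c.tape i := by
  unfold step
  split_ifs with h
  · rfl
  · rcases hc : c.head with _ | j
    · rfl
    · have : i ≠ j := by omega
      simp [Function.update_of_ne this]

/-- Configurations that agree around the head make the same step, also when the tape of one of
them is shifted. -/
theorem step_congr {c c' : M.Config} {d : ℕ} (hs : c'.state = c.state)
    (hh : c'.head + d = c.head) (hd : d = 0 ∨ 0 < c'.head)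
    (ht : ∀ i, c'.head = i + 1 → c'.tape i = c.tape (i + d)) :
    (M.step c').state = (M.step c).state ∧ (M.step c').head + d = (M.step c).head ∧
      ∀ i, c'.head = i + 1 → (M.step c').tape i = (M.step c).tape (i + d) := by
  obtain ⟨s, h, T⟩ := c
  obtain ⟨s', h', T'⟩ := c'
  simp only at hs hh hd ht
  subst hs hh
  unfold step
  split_ifs with hacc
  · exact ⟨rfl, rfl, ht⟩
  · rcases h' with _ | j
    · obtain rfl : d = 0 := by omega
      simp
    · have hj := ht j rfl
      have e : j + 1 + d = j + d + 1 := by omega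
      simp only [e, hj]
      refine ⟨trivial, ?_, ?_⟩
      · cases (M.transition s' (T (j + d))).2.2 <;> simp only [HeadMove.apply] <;> omega
      · intro i hi
        obtain rfl : j = i := by omega
        simp

theorem head_le (x : List α) (t : ℕ) : (M.run x t).head ≤ t := by
  induction t with
  | zero => simp [run, initConfig]
  | succ t ih =>
    rw [run_succ]
    have := step_head_le (M.run x t)
    omega

theorem crossingSeq_succ_of_crosses {x : List α} {p T : ℕ} (h : M.Crosses x p T) :
    M.crossingSeq x p (T + 1) = M.crossingSeq x p T ++ [(M.run x (T + 1)).state] := by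
  simp [crossingSeq, h]

theorem crossingSeq_succ_of_not_crosses {x : List α} {p T : ℕ} (h : ¬ M.Crosses x p T) :
    M.crossingSeq x p (T + 1) = M.crossingSeq x p T := by
  simp [crossingSeq, h]

theorem crossingSeq_prefix (x : List α) (p : ℕ) {T N : ℕ} (h : T ≤ N) :
    M.crossingSeq x p T <+: M.crossingSeq x p N := by
  induction N, h using Nat.le_induction with
  | base => exact List.prefix_rfl
  | succ N _ ih =>
    by_cases hc : M.Crosses x p N
    · rw [crossingSeq_succ_of_crosses hc]
      exact ih.trans (List.prefix_append _ _)
    · rwa [crossingSeq_succ_of_not_crosses hc]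

/-- The head starts to the left of every boundary and each crossing switches sides. Thus equal
crossing counts at two boundaries put the head on the same side of each. -/
theorem odd_length_crossingSeq (x : List α) (p T : ℕ) :
    Odd (M.crossingSeq x p T).length ↔ p < (M.run x T).head := by
  induction T with
  | zero => simp [crossingSeq, run, initConfig]
  | succ T ih =>
    by_cases hc : M.Crosses x p T
    · rw [crossingSeq_succ_of_crosses hc, List.length_append, List.length_singleton,
        Nat.odd_add_one, ih]
      unfold Crosses at hc
      grind
    · rw [crossingSeq_succ_of_not_crosses hc, ih]
      unfold Crosses at hc
      grind

theorem getElem?_crossingSeq {x : List α} {p T N : ℕ} (hT : T < N) (hc : M.Crosses x p T) :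
    (M.crossingSeq x p N)[(M.crossingSeq x p T).length]? = some (M.run x (T + 1)).state := by
  obtain ⟨l, hl⟩ := M.crossingSeq_prefix x p (Nat.succ_le_of_lt hT)
  rw [← hl, Nat.succ_eq_add_one, crossingSeq_succ_of_crosses hc]
  simp

theorem exists_crosses_of_getElem? {x : List α} {p N k : ℕ} {s : M.State}
    (h : (M.crossingSeq x p N)[k]? = some s) :
    ∃ T < N, M.Crosses x p T ∧ (M.crossingSeq x p T).length = k ∧
      (M.run x (T + 1)).state = s := by
  induction N with
  | zero => simp [crossingSeq] at h
  | succ N ih =>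
    by_cases hc : M.Crosses x p N
    · rw [crossingSeq_succ_of_crosses hc] at h
      rcases lt_trichotomy k (M.crossingSeq x p N).length with hk | hk | hk
      · rw [List.getElem?_append_left hk] at h
        obtain ⟨T, hT, h'⟩ := ih h
        exact ⟨T, by omega, h'⟩
      · subst hk
        simp at h
        exact ⟨N, by omega, hc, rfl, h⟩
      · rw [List.getElem?_eq_none (by simp; omega)] at h
        simp at h
    · rw [crossingSeq_succ_of_not_crosses hc] at h
      obtain ⟨T, hT, h'⟩ := ih h
      exact ⟨T, by omega, h'⟩

/-- Between two times with equally many crossings of a boundary, only the side of the boundary on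
which the head is can change. -/
theorem tape_eq_of_length_crossingSeq_eq {x : List α} {p T T' : ℕ}
    (h : (M.crossingSeq x p T).length = (M.crossingSeq x p T').length) (i : ℕ)
    (hi : i < p ↔ p < (M.run x T).head) : (M.run x T).tape i = (M.run x T').tape i := by
  wlog hTT : T ≤ T' generalizing T T'
  · refine (this h.symm ?_ (by omega)).symm
    rw [hi, ← odd_length_crossingSeq, ← odd_length_crossingSeq, h]
  induction T', hTT using Nat.le_induction with
  | base => rfl
  | succ N hN ih =>
    have h1 := (M.crossingSeq_prefix x p hN).length_le
    have h2 := (M.crossingSeq_prefix x p (Nat.le_succ N)).length_le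
    have h3 : (M.crossingSeq x p T).length = (M.crossingSeq x p N).length := by
      simp only [Nat.succ_eq_add_one] at h2
      omega
    rw [ih h3, run_succ, step_tape_of_ne]
    have h4 : p < (M.run x T).head ↔ p < (M.run x N).head := by
      rw [← odd_length_crossingSeq, ← odd_length_crossingSeq, h3]
    omega

/-! ### Cutting a factor out of the input -/

theorem initTape_append_left (a b d : List α) {i : ℕ} (hi : i < a.length) :
    M.initTape (a ++ d) i = M.initTape (a ++ (b ++ d)) i := by
  simp [initTape, List.getElem?_append_left hi]

theorem initTape_append_right (a b d : List α) {i : ℕ} (hi : a.length ≤ i) :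
    M.initTape (a ++ d) i = M.initTape (a ++ (b ++ d)) (i + b.length) := by
  unfold initTape
  rw [List.getElem?_append_right hi, List.getElem?_append_right (by omega),
    List.getElem?_append_right (by omega)]
  congr 2
  omega

/-- If the crossing sequences at the two ends of a factor `b` of the input are equal, then on the
input with `b` removed the machine behaves as before to the left and to the right of `b`. -/
theorem run_append_of_crossingSeq_eq {a b d : List α} {N : ℕ}
    (h : M.crossingSeq (a ++ (b ++ d)) a.length N =
      M.crossingSeq (a ++ (b ++ d)) (a.length + b.length) N) (k : ℕ) :
    (∀ T ≤ N, (M.run (a ++ (b ++ d)) T).head ≤ a.length →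
      (M.crossingSeq (a ++ (b ++ d)) a.length T).length = k →
      ∃ t' t₂, (M.crossingSeq (a ++ (b ++ d)) (a.length + b.length) t₂).length = k ∧
        (M.run (a ++ d) t').state = (M.run (a ++ (b ++ d)) T).state ∧
        (M.run (a ++ d) t').head = (M.run (a ++ (b ++ d)) T).head ∧
        (∀ i < a.length, (M.run (a ++ d) t').tape i = (M.run (a ++ (b ++ d)) T).tape i) ∧
        (∀ i ≥ a.length, (M.run (a ++ d) t').tape i =
          (M.run (a ++ (b ++ d)) t₂).tape (i + b.length))) ∧
    (∀ T ≤ N, a.length + b.length < (M.run (a ++ (b ++ d)) T).head →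
      (M.crossingSeq (a ++ (b ++ d)) (a.length + b.length) T).length = k →
      ∃ t' t₁, (M.crossingSeq (a ++ (b ++ d)) a.length t₁).length = k ∧
        (M.run (a ++ d) t').state = (M.run (a ++ (b ++ d)) T).state ∧
        (M.run (a ++ d) t').head + b.length = (M.run (a ++ (b ++ d)) T).head ∧
        (∀ i < a.length, (M.run (a ++ d) t').tape i = (M.run (a ++ (b ++ d)) t₁).tape i) ∧
        (∀ i ≥ a.length, (M.run (a ++ d) t').tape i =
          (M.run (a ++ (b ++ d)) T).tape (i + b.length))) := by
  set x := a ++ (b ++ d) with hx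
  set p := a.length with hp
  set q := b.length with hq
  -- Both sides are treated together, by induction on the number of crossings; an inner induction on
  -- time follows the run within one side.
  induction k using Nat.strong_induction_on with
  | _ k IH =>
  constructor
  · intro T
    induction T with
    | zero =>
      intro _ _ hk
      exact ⟨0, 0, by simpa [crossingSeq] using hk, rfl, rfl,
        fun i hi => initTape_append_left a b d hi, fun i hi => initTape_append_right a b d hi⟩
    | succ T ihT =>
      intro hTN hhead hk
      by_cases hc : M.Crosses x p T
      -- The head enters the left side from `b`. The crossing of the same index at the other end of
      -- `b` enters the same state; just before it the head is right of `b`, where the induction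
      -- hypothesis for one crossing fewer applies.
      · obtain ⟨T₂, hT₂, hc₂, hk₂, hs₂⟩ := exists_crosses_of_getElem?
          (h ▸ getElem?_crossingSeq (by omega : T < N) hc)
        rw [crossingSeq_succ_of_crosses hc, List.length_append, List.length_singleton] at hk
        have ho := M.odd_length_crossingSeq x p T
        have ho₂ := M.odd_length_crossingSeq x (p + q) T₂
        have hpar : p < (M.run x T).head := by unfold Crosses at hc; omega
        have hpar₂ : p + q < (M.run x T₂).head := ho₂.1 (by rw [hk₂]; exact ho.2 hpar)
        obtain ⟨t', t₁, hk₁, hs, hh, hl, hr⟩ :=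
          (IH (M.crossingSeq x p T).length (by omega)).2 T₂ (by omega) hpar₂ hk₂
        obtain ⟨e1, e2, e3⟩ := step_congr hs hh (Or.inr (by omega)) (fun i hi => hr i (by omega))
        have hd := le_step_head (M.run x T)
        have hd₂ := le_step_head (M.run x T₂)
        unfold Crosses at hc₂
        simp only [run_succ] at hc₂ hhead hs₂ ⊢
        refine ⟨t' + 1, T₂ + 1, ?_, ?_, ?_, ?_, ?_⟩
        · rw [crossingSeq_succ_of_crosses (by unfold Crosses; rwa [run_succ])]
          simp; omega
        · rw [run_succ, e1, hs₂]
        · rw [run_succ]; omega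
        · intro i hi
          rw [run_succ, step_tape_of_ne _ (by omega), step_tape_of_ne _ (by omega), hl i hi]
          -- At `t₁` and `T` the head is on the same excursion to the right of `p`, so the left part
          -- of the tape agrees.
          exact (tape_eq_of_length_crossingSeq_eq hk₁.symm i (by omega)).symm
        · intro i hi
          rw [run_succ, run_succ]
          by_cases hi' : (M.run (a ++ d) t').head = i + 1
          · exact e3 i hi'
          · rw [step_tape_of_ne _ hi', step_tape_of_ne _ (by omega), hr i hi]
      · rw [crossingSeq_succ_of_not_crosses hc] at hk
        have hh0 : (M.run x T).head ≤ p := by unfold Crosses at hc; omega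
        obtain ⟨t', t₂, hk₂, hs, hh, hl, hr⟩ := ihT (by omega) hh0 hk
        obtain ⟨e1, e2, e3⟩ := step_congr (d := 0) hs hh (Or.inl rfl)
          (fun i hi => hl i (by omega))
        refine ⟨t' + 1, t₂, hk₂, ?_, ?_, ?_, ?_⟩
        · rw [run_succ, run_succ, e1]
        · rw [run_succ, run_succ]; exact e2
        · intro i hi
          rw [run_succ, run_succ]
          by_cases hi' : (M.run (a ++ d) t').head = i + 1
          · exact e3 i hi'
          · rw [step_tape_of_ne _ hi', step_tape_of_ne _ (by omega), hl i hi]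
        · intro i hi
          rw [run_succ, step_tape_of_ne _ (by omega), hr i hi]
  · intro T
    induction T with
    | zero =>
      intro _ hhead
      simp [run, initConfig] at hhead
    | succ T ihT =>
      intro hTN hhead hk
      by_cases hc : M.Crosses x (p + q) T
      · obtain ⟨T₁, hT₁, hc₁, hk₁, hs₁⟩ := exists_crosses_of_getElem?
          (h ▸ getElem?_crossingSeq (by omega : T < N) hc)
        rw [crossingSeq_succ_of_crosses hc, List.length_append, List.length_singleton] at hk
        have ho := M.odd_length_crossingSeq x (p + q) T
        have ho₁ := M.odd_length_crossingSeq x p T₁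
        have hpar : (M.run x T).head ≤ p + q := by unfold Crosses at hc; omega
        have hpar₁ : (M.run x T₁).head ≤ p := by rw [hk₁] at ho₁; grind
        obtain ⟨t', t₂, hk₂, hs, hh, hl, hr⟩ :=
          (IH (M.crossingSeq x (p + q) T).length (by omega)).1 T₁ (by omega) hpar₁ hk₁
        obtain ⟨e1, e2, e3⟩ := step_congr (d := 0) hs hh (Or.inl rfl)
          (fun i hi => hl i (by omega))
        have hd := step_head_le (M.run x T)
        have hd₁ := step_head_le (M.run x T₁)
        unfold Crosses at hc₁
        simp only [run_succ] at hc₁ hhead hs₁ ⊢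
        refine ⟨t' + 1, T₁ + 1, ?_, ?_, ?_, ?_, ?_⟩
        · rw [crossingSeq_succ_of_crosses (by unfold Crosses; rwa [run_succ])]
          simp; omega
        · rw [run_succ, e1, hs₁]
        · rw [run_succ]; omega
        · intro i hi
          rw [run_succ, run_succ]
          by_cases hi' : (M.run (a ++ d) t').head = i + 1
          · exact e3 i hi'
          · rw [step_tape_of_ne _ hi', step_tape_of_ne _ (by omega), hl i hi]
        · intro i hi
          rw [run_succ, step_tape_of_ne _ (by omega), step_tape_of_ne _ (by omega), hr i hi]
          exact (tape_eq_of_length_crossingSeq_eq hk₂.symm _ (by omega)).symm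
      · rw [crossingSeq_succ_of_not_crosses hc] at hk
        have hh0 : p + q < (M.run x T).head := by unfold Crosses at hc; omega
        obtain ⟨t', t₁, hk₁, hs, hh, hl, hr⟩ := ihT (by omega) hh0 hk
        obtain ⟨e1, e2, e3⟩ := step_congr hs hh (Or.inr (by omega)) (fun i hi => hr i (by omega))
        refine ⟨t' + 1, t₁, hk₁, ?_, ?_, ?_, ?_⟩
        · rw [run_succ, run_succ, e1]
        · rw [run_succ, run_succ]; exact e2
        · intro i hi
          rw [run_succ, step_tape_of_ne _ (by omega), hl i hi]
        · intro i hi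
          rw [run_succ, run_succ]
          by_cases hi' : (M.run (a ++ d) t').head = i + 1
          · exact e3 i hi'
          · rw [step_tape_of_ne _ hi', step_tape_of_ne _ (by omega), hr i hi]

/-! ### Counting crossings and bounding the head -/

/-- A step moves the head by at most one cell, so it crosses at most one boundary. -/
theorem sum_length_crossingSeq_le (x : List α) (n T : ℕ) :
    ∑ p ∈ Finset.range n, (M.crossingSeq x p T).length ≤ T := by
  classical
  induction T with
  | zero => simp [crossingSeq]
  | succ T ih =>
    have h1 : ∀ p, (M.crossingSeq x p (T + 1)).length =
        (M.crossingSeq x p T).length + if M.Crosses x p T then 1 else 0 := by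
      intro p
      by_cases hc : M.Crosses x p T
      · simp [crossingSeq_succ_of_crosses hc, hc]
      · simp [crossingSeq_succ_of_not_crosses hc, hc]
    simp only [h1, Finset.sum_add_distrib]
    refine Nat.add_le_add ih ?_
    rw [← Finset.card_filter, Finset.card_le_one]
    intro p hp q hq
    have hu := step_head_le (M.run x T)
    have hl := le_step_head (M.run x T)
    simp only [Finset.mem_filter, Crosses, run_succ] at hp hq
    omega

/-- Every computation that is short relative to the length `n` of a sufficiently long input has
equal crossing sequences at two boundaries of the input. -/
theorem exists_crossingSeq_eq (M : PFTuringMachine α) (c : ℕ) :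
    ∃ n₀ : ℕ, ∀ (x : List α) (n : ℕ), n₀ ≤ n →
      ∃ p q, p < q ∧ q ≤ n ∧
        M.crossingSeq x p (c * (n + 1)) = M.crossingSeq x q (c * (n + 1)) := by
  classical
  have := M.finite_state
  have hfin : {l : List M.State | l.length ≤ 2 * c}.Finite := List.finite_length_le _ _
  -- At most half of the n+1 boundaries can have more than 2c crossings; the others must outnumber
  -- the sequences of length at most 2c.
  refine ⟨2 * hfin.toFinset.card, fun x n hn => ?_⟩
  set N := c * (n + 1) with hN
  set good := (Finset.range (n + 1)).filter fun p => (M.crossingSeq x p N).length ≤ 2 * c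
  set bad := (Finset.range (n + 1)).filter fun p => ¬ (M.crossingSeq x p N).length ≤ 2 * c
  have hcard : good.card + bad.card = n + 1 := by
    rw [Finset.card_filter_add_card_filter_not, Finset.card_range]
  have hbad : bad.card * (2 * c + 1) ≤ N := by
    refine le_trans ?_ (M.sum_length_crossingSeq_le x (n + 1) N)
    refine le_trans ?_ (Finset.sum_le_sum_of_subset (Finset.filter_subset _ _ : bad ⊆ _))
    rw [← smul_eq_mul]
    refine Finset.card_nsmul_le_sum _ _ _ fun p hp => ?_
    have := (Finset.mem_filter.1 hp).2
    omega
  have hgood : hfin.toFinset.card < good.card := by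
    have : 2 * bad.card ≤ n + 1 := by
      rcases Nat.eq_zero_or_pos c with rfl | hc
      · simp [hN] at hbad
        simp [hbad]
      · refine Nat.le_of_mul_le_mul_left ?_ hc
        nlinarith
    omega
  obtain ⟨p, hp, q, hq, hpq, he⟩ := Finset.exists_ne_map_eq_of_card_lt_of_maps_to hgood
    (f := fun p => M.crossingSeq x p N) (fun p hp => by
      simpa using (Finset.mem_filter.1 hp).2)
  have hp' := Finset.mem_range.1 (Finset.mem_filter.1 hp).1
  have hq' := Finset.mem_range.1 (Finset.mem_filter.1 hq).1
  rcases lt_or_gt_of_ne hpq with h | h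
  · exact ⟨p, q, h, by omega, he⟩
  · exact ⟨q, p, h, by omega, he.symm⟩

/-- The head of a linear-time machine moves only boundedly far beyond the end of the input. -/
theorem exists_head_le (M : PFTuringMachine α) {c : ℕ}
    (hM : ∀ x : List α, (M.run x (c * (x.length + 1))).state ∈ M.accepting) :
    ∃ K : ℕ, ∀ (x : List α) (t : ℕ), (M.run x t).head ≤ x.length + K := by
  obtain ⟨n₀, hn₀⟩ := M.exists_crossingSeq_eq c
  have key : ∀ (n : ℕ) (x : List α), x.length = n → ∀ t ≤ c * (n + 1),
      (M.run x t).head ≤ n + c * (n₀ + 1) := by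
    intro n
    induction n using Nat.strong_induction_on with
    | _ n IH =>
    intro x hx t ht
    rcases lt_or_ge n n₀ with hn | hn
    · have h1 := M.head_le x t
      have h2 : c * (n + 1) ≤ c * (n₀ + 1) := Nat.mul_le_mul_left _ (by omega)
      omega
    · by_contra! hlt
      obtain ⟨p, q, hpq, hq, he⟩ := hn₀ x n hn
      obtain ⟨a, b, d, rfl, rfl, rfl⟩ : ∃ a b d, x = a ++ (b ++ d) ∧ p = a.length ∧
          q = a.length + b.length := by
        refine ⟨x.take p, (x.drop p).take (q - p), (x.drop p).drop (q - p), ?_, ?_, ?_⟩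
        · simp
        · simp; omega
        · simp; omega
      simp only [List.length_append] at hx
      -- The offending head position is right of `b`, so it occurs on the shorter input too, shifted
      -- by exactly `b.length`: the overshoot is the same.
      obtain ⟨t', _, _, _, hh, _⟩ :=
        (run_append_of_crossingSeq_eq he _).2 t ht (by omega) rfl
      have hlen : (a ++ d).length = a.length + d.length := List.length_append
      have hIH := IH (a ++ d).length (by omega) (a ++ d) rfl
      -- The matching time `t'` is not controlled, but past the time bound the machine has halted.
      rcases le_total t' (c * ((a ++ d).length + 1)) with h' | h'
      · have := hIH t' h'
        omega
      · obtain ⟨j, rfl⟩ := Nat.exists_eq_add_of_le h'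
        rw [run_eq_of_accepting (hM _)] at hh
        have := hIH _ le_rfl
        omega
  refine ⟨c * (n₀ + 1), fun x t => ?_⟩
  rcases le_total t (c * (x.length + 1)) with h | h
  · exact key _ x rfl t h
  · obtain ⟨j, rfl⟩ := Nat.exists_eq_add_of_le h
    rw [run_eq_of_accepting (hM _)]
    exact key _ x rfl _ le_rfl

theorem tape_eq_initTape {x : List α} {i : ℕ} (h : ∀ t, (M.run x t).head ≤ i) (t : ℕ) :
    (M.run x t).tape i = M.initTape x i := by
  induction t with
  | zero => rfl
  | succ t ih =>
    have := h t
    rw [run_succ, step_tape_of_ne _ (by omega), ih]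

end PFTuringMachine

/-! ### Lengths of normal forms -/

open PFTuringMachine

theorem PFLinearTimeComputable.exists_length_le {α : Type*} {f : List α → List α}
    (hf : PFLinearTimeComputable f) : ∃ K : ℕ, ∀ x, (f x).length ≤ x.length + K := by
  obtain ⟨M, c, hM⟩ := hf
  obtain ⟨K, hK⟩ := M.exists_head_le fun x => (hM x).1
  refine ⟨K, fun x => ?_⟩
  by_contra! hlt
  -- Index `x.length + K` denotes the cell one further right, which the head never visits: it is
  -- still blank and cannot hold an output letter.
  have h1 := (hM x).2.1 (x.length + K) hlt
  rw [tape_eq_initTape (hK x)] at h1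
  simp [initTape] at h1

theorem IsCayleyPFLinearTimeRepresentation.exists_length_le {α G : Type*} [Group G]
    {S : Finset G} {L : Language α} {ψ : {w : List α // w ∈ L} → G}
    (hψ : IsCayleyPFLinearTimeRepresentation S L ψ) (g : G) :
    ∃ K : ℕ, ∀ u v : {w : List α // w ∈ L}, ψ v = ψ u * g → v.1.length ≤ u.1.length + K := by
  have hg : g ∈ Submonoid.closure (S : Set G) := by simp [hψ.generates]
  induction hg using Submonoid.closure_induction with
  | mem s hs =>
    obtain ⟨f, hf, hfL, hfψ⟩ := hψ.computable s hs
    obtain ⟨K, hK⟩ := hf.exists_length_le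
    refine ⟨K, fun u v huv => ?_⟩
    obtain rfl : v = ⟨f u.1, hfL u.1 u.2⟩ := hψ.bijective.1 (huv.trans (hfψ u.1 u.2).symm)
    exact hK u.1
  | one =>
    refine ⟨0, fun u v huv => ?_⟩
    rw [hψ.bijective.1 (huv.trans (mul_one _))]
    simp
  | mul g h _ _ ihg ihh =>
    obtain ⟨K₁, h₁⟩ := ihg
    obtain ⟨K₂, h₂⟩ := ihh
    refine ⟨K₁ + K₂, fun u v huv => ?_⟩
    obtain ⟨w, hw⟩ := hψ.bijective.2 (ψ u * g)
    have e₁ := h₁ u w hw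
    have e₂ := h₂ w v (by rw [huv, hw, mul_assoc])
    omega

theorem exists_list_of_length_eq_geodesicLength {G : Type*} [Group G] {A : Finset G}
    (hA : Subgroup.closure (A : Set G) = ⊤) (g : G) :
    ∃ l : List G, (∀ a ∈ l, a ∈ A ∨ a⁻¹ ∈ A) ∧ l.prod = g ∧ l.length = geodesicLength A g := by
  have hne : {n : ℕ | ∃ l : List G, (∀ a ∈ l, a ∈ A ∨ a⁻¹ ∈ A) ∧ l.prod = g ∧
      l.length = n}.Nonempty := by
    have hg : g ∈ Submonoid.closure ((A : Set G) ∪ (A : Set G)⁻¹) := by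
      rw [← Subgroup.closure_toSubmonoid, hA]
      exact Subgroup.mem_top g
    obtain ⟨l, hl, hg⟩ := Submonoid.exists_list_of_mem_closure hg
    exact ⟨l.length, l, by simpa using hl, hg, rfl⟩
  exact Nat.sInf_mem hne

theorem theorem3p3 {α G : Type*} [Finite α] [Group G] (S : Finset G) (L : Language α)
    (ψ : {w : List α // w ∈ L} → G) (hψ : IsCayleyPFLinearTimeRepresentation S L ψ)
    (A : Finset G) (hA : Subgroup.closure (A : Set G) = ⊤) :
    (∃ K : ℕ, 0 < K ∧ ∀ (s : G), (s ∈ A ∨ s⁻¹ ∈ A) → ∀ u v : {w : List α // w ∈ L},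
      ψ v = ψ u * s → |(u.1.length : ℤ) - (v.1.length : ℤ)| ≤ (K : ℤ)) ∧
    (∃ C : ℕ, ∀ w : {w : List α // w ∈ L},
      w.1.length ≤ C * (geodesicLength A (ψ w) + 1)) := by
  choose k hk using hψ.exists_length_le
  obtain ⟨K, hKpos, hK⟩ : ∃ K : ℕ, 0 < K ∧ ∀ s, (s ∈ A ∨ s⁻¹ ∈ A) → k s ≤ K ∧ k s⁻¹ ≤ K := by
    -- The sum dominates every `k a` and `k a⁻¹`; the extra 1 is for positivity.
    refine ⟨∑ a ∈ A, (k a + k a⁻¹) + 1, by omega, ?_⟩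
    have h1 : ∀ a ∈ A, k a + k a⁻¹ ≤ ∑ a ∈ A, (k a + k a⁻¹) := fun a ha =>
      Finset.single_le_sum (f := fun a => k a + k a⁻¹) (fun _ _ => Nat.zero_le _) ha
    rintro s (hs | hs)
    · have := h1 s hs
      omega
    · have := h1 _ hs
      rw [inv_inv] at this
      omega
  refine ⟨⟨K, hKpos, fun s hs u v huv => ?_⟩, ?_⟩
  · have h1 := hk s u v huv
    have h2 := hk s⁻¹ v u (by rw [huv, mul_inv_cancel_right])
    have h3 := hK s hs
    rw [abs_le]
    omega
  · obtain ⟨w₀, hw₀⟩ := hψ.bijective.2 1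
    have hlist : ∀ (l : List G), (∀ a ∈ l, a ∈ A ∨ a⁻¹ ∈ A) → ∀ u v : {w : List α // w ∈ L},
        ψ v = ψ u * l.prod → v.1.length ≤ u.1.length + K * l.length := by
      intro l
      induction l with
      | nil =>
        intro _ u v huv
        rw [hψ.bijective.1 (huv.trans (by simp) : ψ v = ψ u)]
        simp
      | cons a l ih =>
        intro hl u v huv
        obtain ⟨w, hw⟩ := hψ.bijective.2 (ψ u * a)
        have h1 := hk a u w hw
        have h2 := (hK a (hl a (by simp))).1
        have h3 := ih (fun b hb => hl b (by simp [hb])) w v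
          (by rw [huv, hw, List.prod_cons, mul_assoc])
        rw [List.length_cons, Nat.mul_succ]
        omega
    -- A geodesic from the identity, represented by `w₀`, gives the bound `w₀.1.length + K *
    -- l.length`.
    refine ⟨w₀.1.length + K, fun w => ?_⟩
    obtain ⟨l, hl, hprod, hlen⟩ := exists_list_of_length_eq_geodesicLength hA (ψ w)
    have h := hlist l hl w₀ w (by rw [hprod, hw₀, one_mul])
    rw [← hlen]
    nlinarith [Nat.zero_le (w₀.1.length * l.length)]
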